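/- Identify the real projective line $\mathbb{RP}^1$ (lines through $0$ in $\mathbb{R}^2$) with $\mathbb{R}/\pi\mathbb{Z}$ by assigning to $t$ the line spanned by $(\cos t,\sin t)$, equip it with the quotient metric, and for $A\in\mathrm{SL}(2,\mathbb{R})$ let $\phi_A:\mathbb{RP}^1\to\mathbb{RP}^1$ be the map induced by the linear action of $A$. For $\mathcal{A}\subseteq\mathrm{SL}(2,\mathbb{R})$ let $\mathcal{A}^n$ be the set of all products of $n$ elements of $\mathcal{A}$ and $\mathcal{A}^*=\bigcup_{n\ge 1}\mathcal{A}^n$. Call $\mathcal{A}$ *irreducible* if there is no $x\in\mathbb{RP}^1$ with $\phi_A(x)=x$ for all $A\in\mathcal{A}$, and *semidiscrete* if the identity does not belong to the closure of $\mathcal{A}^*$ in $\mathrm{SL}(2,\mathbb{R})$. Call $A \neq \pm\mathrm{Id}$ *hyperbolic* if $|\mathrm{tr} A|>2$ and *parabolic* if $|\mathrm{tr} A|=2$. Let $K_{\mathcal{A}}\subseteq\mathbb{RP}^1$ be the smallest closed set that contains the attracting fixed point of $\phi_A$ (the fixed point $a$ with $|\phi_A'(a)|<1$) for every hyperbolic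 $A\in\mathcal{A}^*$ and the unique fixed point of $\phi_A$ for every parabolic $A\in\mathcal{A}^*$. With $\|\cdot\|$ the Euclidean operator norm, let $$\zeta_{\mathcal{A}}(s)=\sum_{n=1}^\infty\ \sum_{A\in\mathcal{A}^n}\|A\|^{-2s}\in[0,\infty],\qquad \delta_{\mathcal{A}}=\inf\{s>0:\zeta_{\mathcal{A}}(s)<\infty\}\in[0,\infty],$$ where $\inf\emptyset=\infty$. **Proposition.** Let $\mathcal{A}$ be a finite, irreducible and semidiscrete subset of $\mathrm{SL}(2,\mathbb{R})$. Then $$\dim_{\mathrm H}K_{\mathcal{A}}\le\min\{1,\delta_{\mathcal{A}}\}.$$ -/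

import Mathlib

open scoped MatrixGroups Pointwise

noncomputable section

namespace ProjIFS

/-- The real projective line, with the line through `(cos t, sin t)` identified with the class of
`t` in `ℝ / πℤ`; its metric is the quotient metric of `ℝ / πℤ`. -/
abbrev RP1 : Type := AddCircle Real.pi

/-- The vector `A (cos t, sin t)ᵀ`, written as a complex number. -/
def imageVec (A : SL(2, ℝ)) (t : ℝ) : ℂ :=
  ⟨A 0 0 * Real.cos t + A 0 1 * Real.sin t, A 1 0 * Real.cos t + A 1 1 * Real.sin t⟩

lemma imageVec_ne_zero (A : SL(2, ℝ)) (t : ℝ) : imageVec A t ≠ 0 := by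
  intro h
  have h1 : A 0 0 * Real.cos t + A 0 1 * Real.sin t = 0 := congrArg Complex.re h
  have h2 : A 1 0 * Real.cos t + A 1 1 * Real.sin t = 0 := congrArg Complex.im h
  have hd : A 0 0 * A 1 1 - A 0 1 * A 1 0 = 1 := by
    have := A.det_coe
    rwa [Matrix.det_fin_two] at this
  have hc : Real.cos t = 0 := by linear_combination A 1 1 * h1 - A 0 1 * h2 - Real.cos t * hd
  have hs : Real.sin t = 0 := by linear_combination A 0 0 * h2 - A 1 0 * h1 - Real.sin t * hd
  simpa [hc, hs] using Real.sin_sq_add_cos_sq t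

lemma periodic_arg_imageVec (A : SL(2, ℝ)) :
    Function.Periodic (fun t : ℝ => ((imageVec A t).arg : RP1)) Real.pi := by
  intro t
  have hneg : imageVec A (t + Real.pi) = -imageVec A t := by
    apply Complex.ext <;> simp [imageVec] <;> ring
  have h := Complex.arg_neg_coe_angle (imageVec_ne_zero A t)
  rw [← hneg, ← Real.Angle.coe_add, Real.Angle.angle_eq_iff_two_pi_dvd_sub] at h
  obtain ⟨k, hk⟩ := h
  change ((imageVec A (t + Real.pi)).arg : RP1) = ((imageVec A t).arg : RP1)
  rw [← sub_eq_zero, ← AddCircle.coe_sub, AddCircle.coe_eq_zero_iff]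
  refine ⟨2 * k + 1, ?_⟩
  simp only [zsmul_eq_mul]
  push_cast
  linarith

/-- The projective map `φ_A` induced by `A`: the line through `(cos t, sin t)` is sent to the line
through `A (cos t, sin t)ᵀ`, whose angle modulo `π` is the argument of that vector modulo `π`. -/
def projMap (A : SL(2, ℝ)) : RP1 → RP1 := (periodic_arg_imageVec A).lift

/-- The semigroup `𝒜^* = ⋃_{n ≥ 1} 𝒜^n`, where `𝒜^n` is the set of all products of `n` elements
of `𝒜`. -/
def semigroup (𝒜 : Set SL(2, ℝ)) : Set SL(2, ℝ) := ⋃ n : ℕ, 𝒜 ^ (n + 1)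

/-- The identity does not lie in the closure of `𝒜^*` in `SL(2, ℝ)`. -/
def IsSemidiscrete (𝒜 : Set SL(2, ℝ)) : Prop := 1 ∉ closure (semigroup 𝒜)

/-- The maps `φ_A`, `A ∈ 𝒜`, have no common fixed point in the projective line. -/
def IsIrreducible (𝒜 : Set SL(2, ℝ)) : Prop := ¬ ∃ x : RP1, ∀ A ∈ 𝒜, projMap A x = x

/-- `f : RP1 → RP1` has derivative `c` at `x`, computed in the local coordinate of `ℝ / πℤ`:
near a representative `t` of `x`, `f` lifts to a real function with derivative `c` at `t`. -/
def HasProjDerivAt (f : RP1 → RP1) (c : ℝ) (x : RP1) : Prop :=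
  ∃ (t : ℝ) (g : ℝ → ℝ), (t : RP1) = x ∧ (∀ᶠ u in nhds t, ((g u : ℝ) : RP1) = f (u : RP1)) ∧
    HasDerivAt g c t

/-- `x` is a fixed point of `f` at which the derivative of `f` has absolute value less than 1. -/
def IsAttractingFixedPt (f : RP1 → RP1) (x : RP1) : Prop :=
  f x = x ∧ ∃ c : ℝ, |c| < 1 ∧ HasProjDerivAt f c x

/-- `K_𝒜`: the smallest closed set containing the attracting fixed points of the hyperbolic maps
`φ_A` and the fixed points of the parabolic maps `φ_A`, where `A` ranges over `𝒜^*`. For matrices of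
determinant 1, the discriminant `tr(A)² - 4` is positive iff `|tr A| > 2`, and zero iff
`|tr A| = 2`. -/
def attractor (𝒜 : Set SL(2, ℝ)) : Set RP1 :=
  closure {x | ∃ A ∈ semigroup 𝒜,
    ((A : Matrix (Fin 2) (Fin 2) ℝ).IsHyperbolic ∧ IsAttractingFixedPt (projMap A) x) ∨
    ((A : Matrix (Fin 2) (Fin 2) ℝ).IsParabolic ∧ projMap A x = x)}

/-- The Euclidean operator norm of a matrix. -/
def opNorm (A : SL(2, ℝ)) : ℝ :=
  ‖Matrix.toEuclideanCLM (𝕜 := ℝ) (n := Fin 2) (A : Matrix (Fin 2) (Fin 2) ℝ)‖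

/-- `ζ_𝒜(s) = ∑_{n ≥ 1} ∑_{A ∈ 𝒜^n} ‖A‖^{-2s}`, with values in `[0, ∞]`; the inner sum runs over
the set `𝒜^n` of matrices. -/
def zeta (𝒜 : Set SL(2, ℝ)) (s : ℝ) : ENNReal :=
  ∑' n : ℕ, ∑' A : ↥(𝒜 ^ (n + 1)), ENNReal.ofReal (opNorm (A : SL(2, ℝ)) ^ (-2 * s))

/-- `δ_𝒜 = inf {s > 0 : ζ_𝒜(s) < ∞}` in `[0, ∞]`, equal to `∞` if there is no such `s`. -/
def criticalExponent (𝒜 : Set SL(2, ℝ)) : ENNReal :=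
  sInf {δ : ENNReal | ∃ s : ℝ, 0 < s ∧ zeta 𝒜 s < ⊤ ∧ δ = ENNReal.ofReal s}

end ProjIFS

end

/-! Attach to each matrix `Q` the direction `topDirection Q`, the image of a most expanded unit
vector. The action preserves the area form `wedge`, so passing from `Q` to `Q * A` moves this
direction by at most a constant times `‖Q‖⁻²`, uniformly for `A` in the finite set `𝒜`
(`dist_topDirection_mul_le`). Products thus form a tree whose steps have `s`-th powers dominated by
the terms of `zeta 𝒜 s`. When the series converges and `s ≤ 1`, covering by the descendants of
generation `n` costs at most twice a tail of the series, so the limit set is `μH[s]`-null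
(`hausdorffMeasure_eq_zero_of_generations`). The attractor lies in that limit set: each generating
point is a fixed point of some `A` with eigenvalue of modulus at least one, hence within `π / 2 * ‖A
^ k‖⁻¹` of `topDirection (A ^ k)`, and `‖A ^ k‖ → ∞` by convergence of the series. -/

namespace ProjIFS

/-! ### Hausdorff measure of the limit set of a tree of points. -/

section Covering

open MeasureTheory Filter
open scoped ENNReal Topology

variable {α X : Type*}

/-- The ancestor `j` generations up, for a parent map `p k` from generation `k + 1` to
generation `k`, of an element of generation `n + j`. -/
def ancestor (p : ℕ → α → α) (n : ℕ) : ℕ → α → α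
  | 0, a => a
  | j + 1, a => ancestor p n j (p (n + j) a)

lemma ancestor_mem {L : ℕ → Set α} {p : ℕ → α → α} (hp : ∀ n, ∀ a ∈ L (n + 1), p n a ∈ L n)
    (n j : ℕ) : ∀ a ∈ L (n + j), ancestor p n j a ∈ L n := by
  induction j with
  | zero => exact fun a ha => ha
  | succ j ih => exact fun a ha => ih _ (hp _ _ ha)

open Classical in
/-- The total weight of the descendants of `b`, an element of generation `n`. -/
noncomputable def descendantWeight (L : ℕ → Set α) (p : ℕ → α → α) (w : α → ℝ≥0∞) (n : ℕ) (b : α) : ℝ≥0∞ :=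
  ∑' j : ℕ, ∑' a : L (n + j), if ancestor p n j a = b then w a else 0

/-- Each element has only one ancestor in generation `n`, so no weight is counted twice. -/
lemma sum_descendantWeight_le (L : ℕ → Set α) (p : ℕ → α → α) (w : α → ℝ≥0∞) (n : ℕ) :
    ∑' b : L n, descendantWeight L p w n b ≤ ∑' j : ℕ, ∑' a : L (n + j), w a := by
  classical
  unfold descendantWeight
  rw [ENNReal.tsum_comm]
  refine ENNReal.tsum_le_tsum fun j => ?_
  rw [ENNReal.tsum_comm]
  refine ENNReal.tsum_le_tsum fun a => ?_
  by_cases h : ancestor p n j a ∈ L n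
  · rw [tsum_eq_single (⟨_, h⟩ : L n)]
    · simp
    · intro b hb
      rw [if_neg]
      exact fun h' => hb (Subtype.ext h'.symm)
  · rw [ENNReal.tsum_eq_zero.2]
    · exact zero_le
    · intro b
      rw [if_neg]
      exact fun h' => h (h' ▸ b.2)

/-- Triangle inequality along the ancestral path; `s ≤ 1` makes `x ↦ x ^ s` subadditive, and each
step is charged to its own parent. -/
lemma edist_ancestor_rpow_le [PseudoEMetricSpace X] {s : ℝ} (hs0 : 0 < s) (hs1 : s ≤ 1)
    {L : ℕ → Set α} {p : ℕ → α → α} {w : α → ℝ≥0∞} {u : α → X}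
    (hp : ∀ n, ∀ a ∈ L (n + 1), p n a ∈ L n)
    (hw : ∀ n, ∀ a ∈ L (n + 1), edist (u (p n a)) (u a) ^ s ≤ w (p n a))
    (n j : ℕ) (a : α) (ha : a ∈ L (n + j)) :
    edist (u (ancestor p n j a)) (u a) ^ s ≤ descendantWeight L p w n (ancestor p n j a) := by
  classical
  suffices H : ∀ j : ℕ, ∀ a ∈ L (n + j), edist (u (ancestor p n j a)) (u a) ^ s ≤
      ∑ i ∈ Finset.range j, ∑' c : L (n + i),
        if ancestor p n i c = ancestor p n j a then w c else 0 from
    (H j a ha).trans (ENNReal.sum_le_tsum _)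
  intro j
  induction j with
  | zero => intro a _; simp [ancestor, hs0]
  | succ j ih =>
    intro a ha
    have hm : p (n + j) a ∈ L (n + j) := hp _ _ ha
    rw [Finset.sum_range_succ]
    calc edist (u (ancestor p n (j + 1) a)) (u a) ^ s
        ≤ (edist (u (ancestor p n j (p (n + j) a))) (u (p (n + j) a)) +
            edist (u (p (n + j) a)) (u a)) ^ s :=
          ENNReal.rpow_le_rpow (edist_triangle _ _ _) hs0.le
      _ ≤ _ := ENNReal.rpow_add_le_add_rpow _ _ hs0.le hs1
      _ ≤ _ := by
          refine add_le_add (ih _ hm) ((hw _ _ ha).trans ?_)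
          refine le_trans ?_ (ENNReal.le_tsum (⟨_, hm⟩ : L (n + j)))
          simp [ancestor]

/-- If every point of generation `n + 1` is close to a point of generation `n`, with summable
`s`-th powers of the distances, then the set of limits of the generations is null for the
`s`-dimensional Hausdorff measure. -/
theorem hausdorffMeasure_eq_zero_of_generations [EMetricSpace X] [MeasurableSpace X] [BorelSpace X]
    {s : ℝ} (hs0 : 0 < s) (hs1 : s ≤ 1) {L : ℕ → Set α} (hL : ∀ n, (L n).Finite)
    {w : α → ℝ≥0∞} {u : α → X}
    (hstep : ∀ n, ∀ a ∈ L (n + 1), ∃ b ∈ L n, edist (u b) (u a) ^ s ≤ w b)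
    (hsum : ∑' n, ∑' a : L n, w a ≠ ∞) {K : Set X}
    (hK : ∀ n, K ⊆ closure {x | ∃ j, ∃ a ∈ L (n + j), u a = x}) : μH[s] K = 0 := by
  classical
  have hstep' : ∀ n a, ∃ b, a ∈ L (n + 1) → b ∈ L n ∧ edist (u b) (u a) ^ s ≤ w b := by
    intro n a
    by_cases h : a ∈ L (n + 1)
    · obtain ⟨b, hb, hb'⟩ := hstep n a h
      exact ⟨b, fun _ => ⟨hb, hb'⟩⟩
    · exact ⟨a, fun h' => absurd h' h⟩
  choose p hp' using hstep'
  have hp : ∀ n, ∀ a ∈ L (n + 1), p n a ∈ L n := fun n a h => (hp' n a h).1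
  have hw : ∀ n, ∀ a ∈ L (n + 1), edist (u (p n a)) (u a) ^ s ≤ w (p n a) :=
    fun n a h => (hp' n a h).2
  set W := descendantWeight L p w
  -- Taking closures costs no diameter, and finiteness of `L n` keeps the union closed, so limit
  -- points are covered too.
  let D : ∀ n, L n → Set X := fun n b =>
    closure {x | ∃ j, ∃ a ∈ L (n + j), ancestor p n j a = b ∧ u a = x}
  have hD : ∀ n (b : L n), Metric.ediam (D n b) ^ s ≤ 2 * W n b := by
    intro n b
    rw [← ENNReal.le_rpow_inv_iff hs0, Metric.ediam_closure]
    refine Metric.ediam_le ?_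
    rintro _ ⟨j, a, ha, hab, rfl⟩ _ ⟨i, c, hc, hcb, rfl⟩
    rw [ENNReal.le_rpow_inv_iff hs0]
    have h1 := edist_ancestor_rpow_le hs0 hs1 hp hw n j a ha
    have h2 := edist_ancestor_rpow_le hs0 hs1 hp hw n i c hc
    rw [hab] at h1
    rw [hcb] at h2
    calc edist (u a) (u c) ^ s ≤ (edist (u b) (u a) + edist (u b) (u c)) ^ s :=
          ENNReal.rpow_le_rpow (edist_triangle_left _ _ _) hs0.le
      _ ≤ _ := ENNReal.rpow_add_le_add_rpow _ _ hs0.le hs1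
      _ ≤ W n b + W n b := add_le_add h1 h2
      _ = _ := (two_mul _).symm
  let T : ℕ → ℝ≥0∞ := fun n => ∑' j : ℕ, ∑' a : L (n + j), w a
  have hT : Tendsto T atTop (𝓝 0) := by
    have := ENNReal.tendsto_sum_nat_add (fun n => ∑' a : L n, w a) hsum
    refine this.congr fun n => ?_
    exact tsum_congr fun k => by rw [add_comm]
  have hWT : ∀ n, ∑' b : L n, W n b ≤ T n := sum_descendantWeight_le L p w
  have : ∀ n, Fintype (L n) := fun n => (hL n).fintype
  have hT2 : Tendsto (fun n => 2 * T n) atTop (𝓝 0) := by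
    simpa using ENNReal.Tendsto.const_mul hT (Or.inr (by simp : (2 : ℝ≥0∞) ≠ ∞))
  have hr : Tendsto (fun n => (2 * T n) ^ s⁻¹) atTop (𝓝 0) := by
    have := (ENNReal.continuous_rpow_const (y := s⁻¹)).tendsto 0 |>.comp hT2
    rwa [ENNReal.zero_rpow_of_pos (inv_pos.2 hs0)] at this
  have hle : μH[s] K ≤ liminf (fun n => ∑ b, Metric.ediam (D n b) ^ s) atTop := by
    refine Measure.hausdorffMeasure_le_liminf_sum s K _ hr D ?_ ?_
    · refine Eventually.of_forall fun n b => ?_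
      rw [ENNReal.le_rpow_inv_iff hs0]
      exact (hD n b).trans (mul_le_mul_right ((ENNReal.le_tsum b).trans (hWT n)) 2)
    · refine Eventually.of_forall fun n => (hK n).trans ?_
      refine closure_minimal ?_ (isClosed_iUnion_of_finite fun b => isClosed_closure)
      rintro x ⟨j, a, ha, rfl⟩
      exact Set.mem_iUnion.2 ⟨⟨_, ancestor_mem hp n j a ha⟩, subset_closure ⟨j, a, ha, rfl, rfl⟩⟩
  refine le_antisymm (hle.trans ?_) (zero_le)
  rw [← hT2.liminf_eq]
  refine liminf_le_liminf (Eventually.of_forall fun n => ?_)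
  calc ∑ b : L n, Metric.ediam (D n b) ^ s ≤ ∑ b : L n, 2 * W n b := Finset.sum_le_sum fun b _ => hD n b
    _ = 2 * ∑' b : L n, W n b := by rw [← Finset.mul_sum, tsum_fintype]
    _ ≤ 2 * T n := mul_le_mul_right (hWT n) 2

end Covering

lemma dimH_RP1_le_one (K : Set RP1) : dimH K ≤ 1 := by
  have hlip : LipschitzWith 1 (fun t : ℝ => (t : RP1)) := by
    refine LipschitzWith.of_dist_le_mul fun x y => ?_
    rw [dist_eq_norm, dist_eq_norm, ← AddCircle.coe_sub, NNReal.coe_one, one_mul]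
    exact QuotientAddGroup.norm_mk_le_norm
  have hsub : K ⊆ (fun t : ℝ => (t : RP1)) '' Set.univ := by
    rw [Set.image_univ, (QuotientAddGroup.mk_surjective).range_eq]
    exact Set.subset_univ _
  calc dimH K ≤ dimH (Set.univ : Set ℝ) := (dimH_mono hsub).trans (hlip.dimH_image_le _)
    _ = 1 := Real.dimH_univ

end ProjIFS

namespace ProjIFS

/-! ### Angles, the area form and top directions. -/

section Geometry

open Real

/-- The area form on the plane. -/
def wedge (z w : ℂ) : ℝ := z.re * w.im - z.im * w.re

lemma abs_wedge_le (z w : ℂ) : |wedge z w| ≤ ‖z‖ * ‖w‖ := by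
  have h : wedge z w = (starRingEnd ℂ z * w).im := by simp [wedge]; ring
  rw [h]
  simpa using Complex.abs_im_le_norm (starRingEnd ℂ z * w)

/-- The unit vector with angle `t`. -/
noncomputable def dir (t : ℝ) : ℂ := ⟨cos t, sin t⟩

lemma norm_dir (t : ℝ) : ‖dir t‖ = 1 := by
  rw [← sq_eq_sq₀ (norm_nonneg _) zero_le_one, Complex.sq_norm, Complex.normSq_apply]
  simp [dir, ← sq]

lemma dir_ne_zero (t : ℝ) : dir t ≠ 0 := by
  rw [← norm_ne_zero_iff, norm_dir]; exact one_ne_zero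

lemma norm_smul_dir_arg (z : ℂ) : ‖z‖ • dir z.arg = z := by
  apply Complex.ext <;> simp [dir]

lemma dist_coe_le_abs_sin (a b : ℝ) : dist (a : RP1) (b : RP1) ≤ π / 2 * |sin (a - b)| := by
  rw [dist_eq_norm, ← AddCircle.coe_sub, AddCircle.norm_eq]
  -- Shifting by a multiple of `π` brings the difference into `[-π/2, π/2]`, where Jordan's
  -- inequality applies.
  set k := round (π⁻¹ * (a - b))
  have hk : |a - b - k * π| ≤ π / 2 := by
    have h := abs_sub_round (π⁻¹ * (a - b))
    have h2 : a - b - k * π = π * (π⁻¹ * (a - b) - k) := by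
      field_simp
    rw [h2, abs_mul, abs_of_pos pi_pos]
    nlinarith [pi_pos]
  have hs : |sin (a - b - k * π)| = |sin (a - b)| := by
    rw [sin_sub_int_mul_pi, abs_mul]; simp
  have h := mul_abs_le_abs_sin hk
  rw [hs] at h
  calc |a - b - k * π| = π / 2 * (2 / π * |a - b - k * π|) := by field_simp
    _ ≤ _ := by gcongr

lemma abs_sin_eq_of_coe_eq {a b : ℝ} (h : (a : RP1) = (b : RP1)) (c : ℝ) :
    |sin (a - c)| = |sin (b - c)| := by
  rw [← sub_eq_zero, ← AddCircle.coe_sub, AddCircle.coe_eq_zero_iff] at h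
  obtain ⟨k, hk⟩ := h
  have : a - c = b - c + k * π := by
    rw [zsmul_eq_mul] at hk; linarith
  rw [this, sin_add_int_mul_pi, abs_mul]; simp

lemma wedge_dir (a b : ℝ) : wedge (dir a) (dir b) = sin (b - a) := by
  simp [wedge, dir, sin_sub]; ring

lemma wedge_smul_smul (r r' : ℝ) (z w : ℂ) : wedge (r • z) (r' • w) = r * r' * wedge z w := by
  simp [wedge]; ring

lemma abs_wedge_eq (z w : ℂ) : |wedge z w| = ‖z‖ * ‖w‖ * |sin (z.arg - w.arg)| := by
  conv_lhs => rw [← norm_smul_dir_arg z, ← norm_smul_dir_arg w, wedge_smul_smul, wedge_dir]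
  rw [abs_mul, abs_of_nonneg (by positivity), ← neg_sub z.arg, sin_neg, abs_neg]

lemma dist_arg_le {z w : ℂ} (hz : z ≠ 0) (hw : w ≠ 0) :
    dist (z.arg : RP1) (w.arg : RP1) ≤ π / 2 * (|wedge z w| / (‖z‖ * ‖w‖)) := by
  refine (dist_coe_le_abs_sin _ _).trans_eq ?_
  rw [abs_wedge_eq]
  have := norm_pos_iff.2 hz
  have := norm_pos_iff.2 hw
  field_simp

/-- The linear action of `SL(2, ℝ)` on the plane. -/
def act (A : SL(2, ℝ)) (z : ℂ) : ℂ :=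
  ⟨A 0 0 * z.re + A 0 1 * z.im, A 1 0 * z.re + A 1 1 * z.im⟩

lemma imageVec_eq_act (A : SL(2, ℝ)) (t : ℝ) : imageVec A t = act A (dir t) := rfl

lemma act_mul (A B : SL(2, ℝ)) (z : ℂ) : act (A * B) z = act A (act B z) := by
  apply Complex.ext <;>
    simp [act, Matrix.SpecialLinearGroup.coe_mul, Matrix.mul_apply, Fin.sum_univ_two] <;> ring

lemma act_one (z : ℂ) : act 1 z = z := by
  apply Complex.ext <;> simp [act]

lemma act_smul (A : SL(2, ℝ)) (r : ℝ) (z : ℂ) : act A (r • z) = r • act A z := by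
  apply Complex.ext <;> simp [act] <;> ring

lemma det_eq (A : SL(2, ℝ)) : A 0 0 * A 1 1 - A 0 1 * A 1 0 = 1 := by
  have := A.det_coe
  rwa [Matrix.det_fin_two] at this

lemma wedge_act (A : SL(2, ℝ)) (z w : ℂ) : wedge (act A z) (act A w) = wedge z w := by
  simp only [wedge, act]
  linear_combination (z.re * w.im - z.im * w.re) * det_eq A

lemma act_ne_zero (A : SL(2, ℝ)) {z : ℂ} (hz : z ≠ 0) : act A z ≠ 0 := by
  intro h
  apply hz
  have h2 : act A⁻¹ (act A z) = z := by rw [← act_mul, inv_mul_cancel, act_one]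
  rw [← h2, h]
  apply Complex.ext <;> simp [act]

/-- The vector of `EuclideanSpace ℝ (Fin 2)` with the same coordinates as `z`. -/
def toVec (z : ℂ) : EuclideanSpace ℝ (Fin 2) := !₂[z.re, z.im]

lemma norm_toVec (z : ℂ) : ‖toVec z‖ = ‖z‖ := by
  rw [← sq_eq_sq₀ (norm_nonneg _) (norm_nonneg _), Complex.sq_norm, Complex.normSq_apply,
    EuclideanSpace.norm_sq_eq]
  simp [toVec, Fin.sum_univ_two, sq]

lemma toEuclideanCLM_toVec (A : SL(2, ℝ)) (z : ℂ) :
    Matrix.toEuclideanCLM (𝕜 := ℝ) (n := Fin 2) (A : Matrix (Fin 2) (Fin 2) ℝ) (toVec z) =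
      toVec (act A z) := by
  rw [toVec, Matrix.toEuclideanCLM_toLp]
  ext i
  fin_cases i <;> simp [toVec, act, Matrix.mulVec, dotProduct, Fin.sum_univ_two]

lemma norm_act_le (A : SL(2, ℝ)) (z : ℂ) : ‖act A z‖ ≤ opNorm A * ‖z‖ := by
  rw [← norm_toVec, ← toEuclideanCLM_toVec, ← norm_toVec z]
  exact ContinuousLinearMap.le_opNorm _ _

lemma norm_imageVec_le (A : SL(2, ℝ)) (t : ℝ) : ‖imageVec A t‖ ≤ opNorm A := by
  simpa [norm_dir, imageVec_eq_act] using norm_act_le A (dir t)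

lemma opNorm_nonneg (A : SL(2, ℝ)) : 0 ≤ opNorm A := norm_nonneg _

lemma opNorm_pos (A : SL(2, ℝ)) : 0 < opNorm A :=
  (norm_pos_iff.2 (imageVec_ne_zero A 0)).trans_le (norm_imageVec_le A 0)

lemma opNorm_mul_le (A B : SL(2, ℝ)) : opNorm (A * B) ≤ opNorm A * opNorm B := by
  unfold opNorm
  rw [Matrix.SpecialLinearGroup.coe_mul, map_mul]
  exact norm_mul_le _ _

lemma continuous_imageVec (A : SL(2, ℝ)) : Continuous (imageVec A) := by
  have : imageVec A = fun t => Complex.equivRealProdCLM.symm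
      (A 0 0 * cos t + A 0 1 * sin t, A 1 0 * cos t + A 1 1 * sin t) := by
    funext t; apply Complex.ext <;> simp [imageVec]
  rw [this]
  fun_prop

lemma exists_opNorm_le_norm_imageVec (A : SL(2, ℝ)) : ∃ t, opNorm A ≤ ‖imageVec A t‖ := by
  obtain ⟨t, -, ht⟩ := (isCompact_Icc (a := -π) (b := π)).exists_isMaxOn
    ⟨0, by constructor <;> linarith [pi_pos]⟩ (continuous_imageVec A).norm.continuousOn
  refine ⟨t, ContinuousLinearMap.opNorm_le_bound _ (norm_nonneg _) fun v => ?_⟩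
  obtain ⟨z, rfl⟩ : ∃ z, v = toVec z := ⟨⟨v 0, v 1⟩, by ext i; fin_cases i <;> simp [toVec]⟩
  rw [toEuclideanCLM_toVec, norm_toVec, norm_toVec]
  have h := ht ⟨(Complex.neg_pi_lt_arg z).le, Complex.arg_le_pi z⟩
  calc ‖act A z‖ = ‖imageVec A z.arg‖ * ‖z‖ := by
        conv_lhs => rw [← norm_smul_dir_arg z, act_smul, norm_smul, norm_norm]
        rw [imageVec_eq_act, mul_comm]
    _ ≤ _ := mul_le_mul_of_nonneg_right h (norm_nonneg _)

/-- The angle of a most expanded direction of `A`. -/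
noncomputable def expandingAngle (A : SL(2, ℝ)) : ℝ := (exists_opNorm_le_norm_imageVec A).choose

lemma norm_imageVec_expandingAngle (A : SL(2, ℝ)) : ‖imageVec A (expandingAngle A)‖ = opNorm A :=
  le_antisymm (norm_imageVec_le _ _) (exists_opNorm_le_norm_imageVec A).choose_spec

/-- The image of the most expanded direction of `A`. -/
noncomputable def topDirection (A : SL(2, ℝ)) : RP1 := ((imageVec A (expandingAngle A)).arg : RP1)

/-- A bound for how far the top direction moves under multiplication on the right by `A`. -/
lemma dist_topDirection_mul_le (Q A : SL(2, ℝ)) :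
    dist (topDirection Q) (topDirection (Q * A)) ≤
      π / 2 * (opNorm A * opNorm A⁻¹) * (opNorm Q ^ 2)⁻¹ := by
  have hQ := opNorm_pos Q
  have hQA := opNorm_pos (Q * A)
  refine (dist_arg_le (imageVec_ne_zero _ _) (imageVec_ne_zero _ _)).trans ?_
  -- Invariance of the area form cancels `Q` from the numerator, leaving both norms in the
  -- denominator.
  rw [norm_imageVec_expandingAngle, norm_imageVec_expandingAngle, imageVec_eq_act, imageVec_eq_act,
    act_mul, wedge_act, mul_assoc, mul_assoc]
  have h1 : |wedge (dir (expandingAngle Q)) (act A (dir (expandingAngle (Q * A))))| ≤ opNorm A := by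
    refine (abs_wedge_le _ _).trans ?_
    rw [norm_dir, one_mul]
    exact norm_imageVec_le _ _
  have h2 : opNorm Q ≤ opNorm (Q * A) * opNorm A⁻¹ := by
    simpa using opNorm_mul_le (Q * A) A⁻¹
  gcongr ?_ * ?_
  have h3 : (opNorm (Q * A))⁻¹ ≤ opNorm A⁻¹ * (opNorm Q)⁻¹ := by
    rw [← div_eq_mul_inv, le_div_iff₀ hQ, inv_mul_le_iff₀ hQA]
    exact h2
  calc _ ≤ opNorm A / (opNorm Q * opNorm (Q * A)) := by gcongr
    _ = opNorm A * (opNorm Q)⁻¹ * (opNorm (Q * A))⁻¹ := by field_simp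
    _ ≤ opNorm A * (opNorm Q)⁻¹ * (opNorm A⁻¹ * (opNorm Q)⁻¹) :=
      mul_le_mul_of_nonneg_left h3 (mul_nonneg (opNorm_nonneg _) (inv_nonneg.2 hQ.le))
    _ = _ := by field_simp

lemma projMap_coe (A : SL(2, ℝ)) (t : ℝ) : projMap A (t : RP1) = ((imageVec A t).arg : RP1) := rfl

lemma smul_dir_of_coe_arg_eq {z : ℂ} {t : ℝ} (h : (z.arg : RP1) = (t : RP1)) :
    ∃ r : ℝ, z = r • dir t := by
  rw [← sub_eq_zero, ← AddCircle.coe_sub, AddCircle.coe_eq_zero_iff] at h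
  obtain ⟨k, hk⟩ := h
  have hk' : z.arg = t + k * π := by rw [zsmul_eq_mul] at hk; linarith
  refine ⟨‖z‖ * (-1) ^ k, ?_⟩
  have hdir : dir (t + k * π) = ((-1 : ℝ) ^ k) • dir t := by
    generalize he : (-1 : ℝ) ^ k = e
    apply Complex.ext <;> simp [dir, sin_add_int_mul_pi, cos_add_int_mul_pi, he]
  conv_lhs => rw [← norm_smul_dir_arg z, hk', hdir, smul_smul]

lemma exists_eigenvalue_of_fixed {A : SL(2, ℝ)} {t : ℝ} (h : projMap A (t : RP1) = (t : RP1)) :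
    ∃ r : ℝ, act A (dir t) = r • dir t :=
  smul_dir_of_coe_arg_eq ((projMap_coe A t).symm.trans h)

lemma act_pow_of_eigen {A : SL(2, ℝ)} {r : ℝ} {z : ℂ} (h : act A z = r • z) (k : ℕ) :
    act (A ^ k) z = r ^ k • z := by
  induction k with
  | zero => simp [act_one]
  | succ k ih => rw [pow_succ, act_mul, h, act_smul, ih, smul_smul, pow_succ, mul_comm]

lemma coe_arg_smul_dir {r : ℝ} (hr : r ≠ 0) (t : ℝ) : (((r • dir t).arg : ℝ) : RP1) = (t : RP1) := by
  have h0 : r • dir t ≠ 0 := smul_ne_zero hr (dir_ne_zero t)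
  have h1 : wedge (r • dir t) (dir t) = 0 := by simp [wedge]; ring
  rw [← dist_le_zero]
  refine (dist_coe_le_abs_sin _ _).trans_eq ?_
  have h2 : wedge (‖r • dir t‖ • dir (r • dir t).arg) ((1 : ℝ) • dir t) = 0 := by
    rw [norm_smul_dir_arg, one_smul, h1]
  rw [wedge_smul_smul, wedge_dir] at h2
  have h3 : sin (t - (r • dir t).arg) = 0 := by
    simpa [norm_ne_zero_iff, hr, dir_ne_zero] using h2
  rw [← neg_sub, sin_neg, h3]; simp

/-- Top directions are close to the fixed points with eigenvalue at least one in absolute value. -/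
lemma dist_topDirection_le_of_eigen {A : SL(2, ℝ)} {r t : ℝ} (h : act A (dir t) = r • dir t)
    (hr : 1 ≤ |r|) : dist (topDirection A) (t : RP1) ≤ π / 2 * (opNorm A)⁻¹ := by
  have hr0 : r ≠ 0 := by rintro rfl; simp at hr; linarith
  rw [← coe_arg_smul_dir hr0 t]
  refine (dist_arg_le (imageVec_ne_zero _ _) (smul_ne_zero hr0 (dir_ne_zero t))).trans ?_
  rw [norm_imageVec_expandingAngle, imageVec_eq_act, ← h, wedge_act, h, norm_smul, norm_dir, mul_one,
    norm_eq_abs]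
  have h1 : |wedge (dir (expandingAngle A)) (dir t)| ≤ 1 := by
    simpa [norm_dir] using abs_wedge_le (dir (expandingAngle A)) (dir t)
  have := opNorm_pos A
  gcongr
  rw [inv_eq_one_div]
  gcongr
  nlinarith

lemma abs_eigenvalue_of_isParabolic {A : SL(2, ℝ)} {r t : ℝ} (h : act A (dir t) = r • dir t)
    (hA : (A : Matrix (Fin 2) (Fin 2) ℝ).IsParabolic) : |r| = 1 := by
  have hd := hA.2
  rw [Matrix.discr_fin_two, Matrix.trace_fin_two, A.det_coe] at hd
  have h1 : A 0 0 * cos t + A 0 1 * sin t = r * cos t := by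
    simpa [dir, act] using congrArg Complex.re h
  have h2 : A 1 0 * cos t + A 1 1 * sin t = r * sin t := by
    simpa [dir, act] using congrArg Complex.im h
  have hc : (r ^ 2 - (A 0 0 + A 1 1) * r + 1) * cos t = 0 := by
    linear_combination (A 1 1 - r) * h1 - A 0 1 * h2 - cos t * det_eq A
  have hs : (r ^ 2 - (A 0 0 + A 1 1) * r + 1) * sin t = 0 := by
    linear_combination (A 0 0 - r) * h2 - A 1 0 * h1 - sin t * det_eq A
  have hchar : r ^ 2 - (A 0 0 + A 1 1) * r + 1 = 0 := by
    linear_combination cos t * hc + sin t * hs -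
      (r ^ 2 - (A 0 0 + A 1 1) * r + 1) * sin_sq_add_cos_sq t
  -- Discriminant zero makes the characteristic polynomial a perfect square.
  have h3 : (2 * r - (A 0 0 + A 1 1)) ^ 2 = 0 := by linear_combination 4 * hchar + hd
  have h4 : 2 * r = A 0 0 + A 1 1 := by linarith [pow_eq_zero_iff (two_ne_zero) |>.1 h3]
  have h5 : r ^ 2 = 1 := by rw [← h4] at hchar; linarith
  rwa [← sq_abs, pow_eq_one_iff_of_nonneg (abs_nonneg r) two_ne_zero] at h5

-- The derivative of the projective map at a fixed direction has modulus `r⁻²`. Sines of angle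
-- differences replace the angles, which are only defined modulo `π`.
open Filter Topology in
lemma one_le_abs_eigenvalue_of_deriv {A : SL(2, ℝ)} {r t c : ℝ} {g : ℝ → ℝ}
    (h : act A (dir t) = r • dir t) (hg : ∀ᶠ u in 𝓝 t, ((g u : ℝ) : RP1) = projMap A (u : RP1))
    (hgd : HasDerivAt g c t) (hc : |c| < 1) : 1 ≤ |r| := by
  have hr0 : r ≠ 0 := by
    rintro rfl
    exact act_ne_zero A (dir_ne_zero t) (by simpa using h)
  have hgt : ((g t : ℝ) : RP1) = (t : RP1) := by
    rw [hg.self_of_nhds, projMap_coe, imageVec_eq_act, h, coe_arg_smul_dir hr0]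
  have hsin : HasDerivAt (fun u => sin (g u - g t)) c t := by
    simpa using (hgd.sub_const (g t)).sin
  have hsin' : HasDerivAt (fun u => sin (u - t)) 1 t := by
    simpa using ((hasDerivAt_id t).sub_const t).sin
  have key : ∀ᶠ u in 𝓝 t, |sin (u - t)| = |r| * ‖imageVec A u‖ * |sin (g u - g t)| := by
    filter_upwards [hg] with u hu
    have e1 : |sin (g u - g t)| = |sin ((imageVec A u).arg - (r • dir t).arg)| := by
      rw [abs_sin_eq_of_coe_eq (hu.trans (projMap_coe A u)), ← neg_sub, sin_neg, abs_neg,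
        abs_sin_eq_of_coe_eq (hgt.trans (coe_arg_smul_dir hr0 t).symm), ← neg_sub, sin_neg, abs_neg]
    have e2 := abs_wedge_eq (imageVec A u) (r • dir t)
    rw [norm_smul, norm_dir, mul_one, norm_eq_abs, ← e1, imageVec_eq_act, ← h, wedge_act,
      wedge_dir, ← neg_sub, sin_neg, abs_neg] at e2
    rw [e2, imageVec_eq_act]; ring
  have l1 : Tendsto (fun u => |slope (fun u => sin (u - t)) t u|) (𝓝[≠] t) (𝓝 |1|) :=
    hsin'.tendsto_slope.abs
  have l2 : Tendsto (fun u => |r| * ‖imageVec A u‖ * |slope (fun u => sin (g u - g t)) t u|)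
      (𝓝[≠] t) (𝓝 (|r| * ‖imageVec A t‖ * |c|)) :=
    (((continuous_imageVec A).norm.tendsto t).mono_left nhdsWithin_le_nhds |>.const_mul _).mul
      hsin.tendsto_slope.abs
  have e : (fun u => |slope (fun u => sin (u - t)) t u|) =ᶠ[𝓝[≠] t]
      fun u => |r| * ‖imageVec A u‖ * |slope (fun u => sin (g u - g t)) t u| := by
    filter_upwards [key.filter_mono nhdsWithin_le_nhds] with u hu
    simp only [slope_def_field, sub_self, sin_zero, sub_zero, abs_div, hu, mul_div_assoc]
  -- Both limits of the difference quotients agree: `1 = |r| ^ 2 * |c|`.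
  have := tendsto_nhds_unique (l1.congr' e) l2
  rw [imageVec_eq_act, h, norm_smul, norm_dir, mul_one, norm_eq_abs, abs_one] at this
  by_contra! hlt
  nlinarith [abs_nonneg r, abs_nonneg c, mul_nonneg (abs_nonneg r) (abs_nonneg r)]

end Geometry

end ProjIFS

namespace ProjIFS

/-! ### The attractor as part of the limit set. -/

open Filter Topology MeasureTheory

/-- Powers of `A` occur in ever higher levels of the series, whose level sums tend to zero. -/
lemma tendsto_opNorm_inv_pow {𝒜 : Set SL(2, ℝ)} {s : ℝ} (hs : 0 < s) (hz : zeta 𝒜 s < ⊤)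
    {m : ℕ} {A : SL(2, ℝ)} (hA : A ∈ 𝒜 ^ (m + 1)) :
    Tendsto (fun k : ℕ => (opNorm (A ^ (k + 1)))⁻¹) atTop (𝓝 0) := by
  have hlevel := ENNReal.tendsto_atTop_zero_of_tsum_ne_top hz.ne
  have hidx : Tendsto (fun k : ℕ => m * (k + 1) + k) atTop atTop :=
    tendsto_atTop_mono (fun k => Nat.le_add_left _ _) tendsto_id
  have h1 : Tendsto (fun k : ℕ => ENNReal.ofReal (opNorm (A ^ (k + 1)) ^ (-2 * s))) atTop (𝓝 0) := by
    refine tendsto_of_tendsto_of_tendsto_of_le_of_le tendsto_const_nhds (hlevel.comp hidx)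
      (fun k => zero_le) fun k => ?_
    have hmem : A ^ (k + 1) ∈ 𝒜 ^ (m * (k + 1) + k + 1) := by
      have := Set.pow_mem_pow hA (n := k + 1)
      rw [← pow_mul] at this
      convert this using 2
      ring
    exact ENNReal.le_tsum (f := fun B : ↥(𝒜 ^ (m * (k + 1) + k + 1)) =>
      ENNReal.ofReal (opNorm (B : SL(2, ℝ)) ^ (-2 * s))) ⟨_, hmem⟩
  have h2 : Tendsto (fun k : ℕ => opNorm (A ^ (k + 1)) ^ (-2 * s)) atTop (𝓝 0) := by
    have := (ENNReal.tendsto_toReal ENNReal.zero_ne_top).comp h1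
    refine this.congr fun k => ?_
    exact ENNReal.toReal_ofReal (Real.rpow_nonneg (opNorm_nonneg _) _)
  have h3 := h2.rpow_const (p := (2 * s)⁻¹) (Or.inr (by positivity))
  rw [Real.zero_rpow (by positivity)] at h3
  refine h3.congr fun k => ?_
  rw [← Real.rpow_mul (opNorm_nonneg _), neg_mul, neg_mul, mul_inv_cancel₀ (by positivity),
    Real.rpow_neg_one]

lemma exists_eigen_of_generator {A : SL(2, ℝ)} {x : RP1}
    (h : ((A : Matrix (Fin 2) (Fin 2) ℝ).IsHyperbolic ∧ IsAttractingFixedPt (projMap A) x) ∨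
      ((A : Matrix (Fin 2) (Fin 2) ℝ).IsParabolic ∧ projMap A x = x)) :
    ∃ r t : ℝ, (t : RP1) = x ∧ act A (dir t) = r • dir t ∧ 1 ≤ |r| := by
  rcases h with ⟨-, hfix, c, hc, t, g, rfl, hg, hgd⟩ | ⟨hp, hfix⟩
  · obtain ⟨r, hr⟩ := exists_eigenvalue_of_fixed hfix
    exact ⟨r, t, rfl, hr, one_le_abs_eigenvalue_of_deriv hr hg hgd hc⟩
  · obtain ⟨t, rfl⟩ := QuotientAddGroup.mk_surjective x
    obtain ⟨r, hr⟩ := exists_eigenvalue_of_fixed hfix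
    exact ⟨r, t, rfl, hr, (abs_eigenvalue_of_isParabolic hr hp).ge⟩

lemma attractor_subset_closure_topDirection {𝒜 : Set SL(2, ℝ)} {s : ℝ} (hs : 0 < s)
    (hz : zeta 𝒜 s < ⊤) (n : ℕ) :
    attractor 𝒜 ⊆ closure {x | ∃ j, ∃ A ∈ 𝒜 ^ (n + j + 1), topDirection A = x} := by
  refine closure_minimal ?_ isClosed_closure
  rintro x ⟨A, hA, hx⟩
  obtain ⟨m, hm⟩ := Set.mem_iUnion.1 hA
  obtain ⟨r, t, rfl, hr, hr1⟩ := exists_eigen_of_generator hx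
  have hlim : Tendsto (fun k : ℕ => topDirection (A ^ (k + 1))) atTop (𝓝 (t : RP1)) := by
    rw [tendsto_iff_dist_tendsto_zero]
    refine squeeze_zero (fun _ => dist_nonneg) (fun k =>
      dist_topDirection_le_of_eigen (act_pow_of_eigen hr (k + 1)) ?_)
      (by simpa using (tendsto_opNorm_inv_pow hs hz hm).const_mul (Real.pi / 2))
    rw [abs_pow]
    exact one_le_pow₀ hr1
  refine mem_closure_of_tendsto hlim ?_
  filter_upwards [eventually_ge_atTop n] with k hk
  -- `A ^ (k + 1)` is a product of `(m + 1) * (k + 1)` generators, which must equal `n + j + 1`.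
  refine ⟨(m + 1) * (k + 1) - n - 1, _, ?_, rfl⟩
  have hle : n + 1 ≤ (m + 1) * (k + 1) := by nlinarith
  have := Set.pow_mem_pow hm (n := k + 1)
  rw [← pow_mul] at this
  convert this using 2
  omega

lemma finite_pow {M : Type*} [Monoid M] {S : Set M} (hS : S.Finite) (n : ℕ) : (S ^ n).Finite := by
  induction n with
  | zero => simp
  | succ n ih => rw [pow_succ]; exact ih.mul hS

theorem hausdorffMeasure_attractor_eq_zero {𝒜 : Set SL(2, ℝ)} (hfin : 𝒜.Finite) {s : ℝ}
    (hs0 : 0 < s) (hs1 : s ≤ 1) (hz : zeta 𝒜 s < ⊤) : μH[s] (attractor 𝒜) = 0 := by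
  obtain ⟨C, hC⟩ : ∃ C, ∀ A ∈ 𝒜, Real.pi / 2 * (opNorm A * opNorm A⁻¹) ≤ C := by
    obtain ⟨C, hC⟩ := (hfin.image fun A => Real.pi / 2 * (opNorm A * opNorm A⁻¹)).bddAbove
    exact ⟨C, fun A hA => hC ⟨A, hA, rfl⟩⟩
  refine hausdorffMeasure_eq_zero_of_generations hs0 hs1 (L := fun n => 𝒜 ^ (n + 1))
    (u := topDirection)
    (w := fun A => ENNReal.ofReal (C ^ s) * ENNReal.ofReal (opNorm A ^ (-2 * s)))
    (fun n => finite_pow hfin (n + 1)) ?_ ?_ (attractor_subset_closure_topDirection hs0 hz)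
  · intro n B hB
    rw [pow_succ] at hB
    -- The parent of a product is obtained by dropping its last factor.
    obtain ⟨Q, hQ, A, hA, rfl⟩ := Set.mem_mul.1 hB
    refine ⟨Q, hQ, ?_⟩
    have hQ0 := opNorm_pos Q
    have hd : dist (topDirection Q) (topDirection (Q * A)) ≤ C * (opNorm Q ^ 2)⁻¹ :=
      (dist_topDirection_mul_le Q A).trans (by gcongr; exact hC A hA)
    have hC0 : 0 ≤ C := le_trans (mul_nonneg (by positivity)
      (mul_nonneg (opNorm_nonneg _) (opNorm_nonneg _))) (hC A hA)
    rw [edist_dist, ENNReal.ofReal_rpow_of_nonneg dist_nonneg hs0.le,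
      ← ENNReal.ofReal_mul (by positivity)]
    refine ENNReal.ofReal_le_ofReal ((Real.rpow_le_rpow dist_nonneg hd hs0.le).trans_eq ?_)
    rw [Real.mul_rpow hC0 (by positivity), neg_mul, Real.rpow_neg hQ0.le, Real.rpow_mul hQ0.le,
      Real.inv_rpow (by positivity), Real.rpow_two]
  · simp only [ENNReal.tsum_mul_left]
    exact ENNReal.mul_ne_top ENNReal.ofReal_ne_top hz.ne

end ProjIFS

theorem proposition6p8 (𝒜 : Set SL(2, ℝ)) (hfin : 𝒜.Finite)
    (hirr : ProjIFS.IsIrreducible 𝒜) (hsemi : ProjIFS.IsSemidiscrete 𝒜) :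
    dimH (ProjIFS.attractor 𝒜) ≤ min 1 (ProjIFS.criticalExponent 𝒜) := by
  refine le_min (ProjIFS.dimH_RP1_le_one _) (le_sInf ?_)
  rintro _ ⟨s, hs, hz, rfl⟩
  rcases le_total s 1 with h | h
  · refine dimH_le_of_hausdorffMeasure_ne_top (d := s.toNNReal) ?_
    rw [Real.coe_toNNReal s hs.le, ProjIFS.hausdorffMeasure_attractor_eq_zero hfin hs h hz]
    exact ENNReal.zero_ne_top
  · exact (ProjIFS.dimH_RP1_le_one _).trans (by simpa using h)
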